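/- **Theorem 3.1.** Let $X$ be a reflexive Banach space over $\mathbb C$ (or over $\mathbb R$), let $T\ge 0$, and let $X^*$ be the space of bounded conjugate-linear functionals on $X$, with the pairing $\langle y,x\rangle=y(x)$ for $y\in X^*$, $x\in X$. Identify $X^{**}$ with $X$, so that the adjoint of $A\in\mathcal L(X,X^*)$ is the operator $A^*\in\mathcal L(X,X^*)$ with $\langle Ax_1,x_2\rangle=\overline{\langle A^*x_2,x_1\rangle}$, and the adjoint of $A\in\mathcal L(X^*,X)$ is the operator $A^*\in\mathcal L(X^*,X)$ with $\langle y_1,Ay_2\rangle=\overline{\langle y_2,A^*y_1\rangle}$. Such an $A$ is self-adjoint if $A=A^*$; a self-adjoint $A$ is nonnegative, $A\ge 0$, if $\langle Ax,x\rangle\ge 0$ for all $x\in X$, respectively $\langle y,Ay\rangle\ge 0$ for all $y\in X^*$. For Banach spaces $Y,Z$ write $P\in C_s([0,T];\mathcal L(Y,Z))$ if $P(t)\in\mathcal L(Y,Z)$ for $t\in[0,T]$ and $t\mapsto P(t)y$ is continuous on $[0,T]$ for every $y\in Y$. Let $\{U_{t,s}\}_{0\le s\le t\le T}\subset\mathcal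 L(X)$ be a strongly continuous, uniformly bounded forward evolution family: $U_{s,s}=I$; $U_{t,s}=U_{t,r}U_{r,s}$ for $0\le s\le r\le t\le T$; $U_{t,s}$ is strongly continuous in $t$ for each fixed $s$ and in $s$ for each fixed $t$; and $\sup_{0\le s\le t\le T}\|U_{t,s}\|<\infty$. Suppose that the backward evolution family $V_{t,s}=(U_{s,t})^*\in\mathcal L(X^*)$, $0\le t\le s\le T$, is also strongly continuous in $t$ for each fixed $s$ and in $s$ for each fixed $t$. Let $C\in C_s([0,T];\mathcal L(X,X^*))$ and $B\in C_s([0,T];\mathcal L(X^*,X))$ satisfy $C(t)=C(t)^*\ge 0$ and $B(t)=B(t)^*\ge 0$ for all $t\in[0,T]$. Then for every self-adjoint nonnegative $G\in\mathcal L(X,X^*)$ the backward Riccati integral equation $$P(t)=V_{t,T}\,G\,U_{T,t}+\int_t^T V_{t,r}\{C(r)-P(r)B(r)P(r)\}U_{r,t}\,dr,\qquad t\in[0,T],$$ with the integral understood in the strong sense (after application to each $x\in X$), has a unique solution $P\in C_s([0,T];\mathcal L(X,X^*))$, and $P(t)=P(t)^*\ge 0$ for all $t\in[0,T]$. -/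

import Mathlib

open Set

section RiccatiDefs

variable {𝕜 : Type*} [RCLike 𝕜]
variable {X : Type*} [NormedAddCommGroup X] [NormedSpace 𝕜 X]
variable {Y : Type*} [NormedAddCommGroup Y] [NormedSpace 𝕜 Y]

/-- The dual space `X*`, with duality `⟨y, x⟩ = y x`: the bounded conjugate-linear
functionals on `X`, with the operator norm. The pairing is linear in `y` and conjugate-linear in
`x`, so that `⟨A x₁, x₂⟩ = conj ⟨A* x₂, x₁⟩` for a linear `A : X → X*`. Over `ℝ` this is the usual
dual. -/
abbrev AntiDual (𝕜 : Type*) [RCLike 𝕜] (X : Type*) [NormedAddCommGroup X] [NormedSpace 𝕜 X] :=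
  X →L⋆[𝕜] 𝕜

/-- Reflexivity: the canonical map of `X` into its (linear) bidual is onto. -/
def IsReflexiveSpace (𝕜 : Type*) [RCLike 𝕜] (X : Type*) [NormedAddCommGroup X]
    [NormedSpace 𝕜 X] : Prop :=
  Function.Surjective (NormedSpace.inclusionInDoubleDual 𝕜 X)

/-- The adjoint `A* : Y* → X*` of `A : X → Y`, `⟨A* y, x⟩ = ⟨y, A x⟩`. -/
noncomputable def dualAdjoint (A : X →L[𝕜] Y) : AntiDual 𝕜 Y →L[𝕜] AntiDual 𝕜 X :=
  (ContinuousLinearMap.compSL X Y 𝕜 (RingHom.id 𝕜) (starRingEnd 𝕜)).flip A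

@[simp] theorem dualAdjoint_apply (A : X →L[𝕜] Y) (y : AntiDual 𝕜 Y) (x : X) :
    dualAdjoint A y x = y (A x) := rfl

/-- The canonical map `X → X**`, `⟨J x, y⟩ = conj ⟨y, x⟩`. -/
noncomputable def canonicalBidual (𝕜 : Type*) [RCLike 𝕜] (X : Type*) [NormedAddCommGroup X]
    [NormedSpace 𝕜 X] : X →L[𝕜] AntiDual 𝕜 (AntiDual 𝕜 X) :=
  LinearMap.mkContinuous
    { toFun := fun x => LinearMap.mkContinuous
        { toFun := fun y : AntiDual 𝕜 X => starRingEnd 𝕜 (y x)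
          map_add' := fun y z => by simp
          map_smul' := fun c y => by simp } ‖x‖
        (fun y => by
          simpa [mul_comm] using y.le_opNorm x)
      map_add' := fun x z => by ext y; simp
      map_smul' := fun c x => by ext y; simp } 1
    (fun x => by
      rw [one_mul]
      refine ContinuousLinearMap.opNorm_le_bound _ (norm_nonneg x) fun y => ?_
      simpa [mul_comm] using y.le_opNorm x)

@[simp] theorem canonicalBidual_apply (x : X) (y : AntiDual 𝕜 X) :
    canonicalBidual 𝕜 X x y = starRingEnd 𝕜 (y x) := rfl

/-- `A : X → X*` is self-adjoint: `A* : X** → X*`, restricted to `X` along the canonical map,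
equals `A`. -/
def IsSelfAdjointToDual (A : X →L[𝕜] AntiDual 𝕜 X) : Prop :=
  (dualAdjoint A).comp (canonicalBidual 𝕜 X) = A

/-- `A : X* → X` is self-adjoint: `A* : X* → X**` is `A` followed by the canonical map. -/
def IsSelfAdjointFromDual (A : AntiDual 𝕜 X →L[𝕜] X) : Prop :=
  dualAdjoint A = (canonicalBidual 𝕜 X).comp A

/-- `A = A* ≥ 0` for `A : X → X*`. By self-adjointness `⟨A x, x⟩` is real, so that taking its real
part loses nothing. -/
structure IsNonnegToDual (A : X →L[𝕜] AntiDual 𝕜 X) : Prop where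
  selfAdjoint : IsSelfAdjointToDual A
  nonneg : ∀ x : X, 0 ≤ RCLike.re (A x x)

/-- `A = A* ≥ 0` for `A : X* → X`. By self-adjointness `⟨y, A y⟩` is real. -/
structure IsNonnegFromDual (A : AntiDual 𝕜 X →L[𝕜] X) : Prop where
  selfAdjoint : IsSelfAdjointFromDual A
  nonneg : ∀ y : AntiDual 𝕜 X, 0 ≤ RCLike.re (y (A y))

theorem isSelfAdjointToDual_iff (A : X →L[𝕜] AntiDual 𝕜 X) :
    IsSelfAdjointToDual A ↔ ∀ x₁ x₂ : X, A x₁ x₂ = starRingEnd 𝕜 (A x₂ x₁) := by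
  constructor
  · intro h x₁ x₂
    exact (congrArg (fun f : X →L[𝕜] AntiDual 𝕜 X => f x₁ x₂) h).symm
  · intro h
    ext x₁ x₂
    exact (h x₁ x₂).symm

theorem isSelfAdjointFromDual_iff (A : AntiDual 𝕜 X →L[𝕜] X) :
    IsSelfAdjointFromDual A ↔
      ∀ y₁ y₂ : AntiDual 𝕜 X, y₁ (A y₂) = starRingEnd 𝕜 (y₂ (A y₁)) := by
  constructor
  · intro h y₁ y₂
    exact congrArg (fun f : AntiDual 𝕜 X →L[𝕜] AntiDual 𝕜 (AntiDual 𝕜 X) => f y₁ y₂) h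
  · intro h
    ext y₁ y₂
    exact h y₁ y₂

/-- `P ∈ C_s([0,T]; L(X,Y))`. Operator functions are total functions of which only the values on
`[0,T]` matter. -/
def StronglyContinuousOp (T : ℝ) (P : ℝ → X →L[𝕜] Y) : Prop :=
  ∀ x : X, ContinuousOn (fun t => P t x) (Icc 0 T)

/-- A forward evolution family `U t s`, `0 ≤ s ≤ t ≤ T`. -/
structure IsForwardEvolutionFamily (T : ℝ) (U : ℝ → ℝ → X →L[𝕜] X) : Prop where
  refl : ∀ s ∈ Icc 0 T, U s s = ContinuousLinearMap.id 𝕜 X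
  comp : ∀ s r t, 0 ≤ s → s ≤ r → r ≤ t → t ≤ T → U t s = (U t r).comp (U r s)

/-- A backward evolution family `V t s`, `0 ≤ t ≤ s ≤ T`. -/
structure IsBackwardEvolutionFamily (T : ℝ) (V : ℝ → ℝ → X →L[𝕜] X) : Prop where
  refl : ∀ s ∈ Icc 0 T, V s s = ContinuousLinearMap.id 𝕜 X
  comp : ∀ t r s, 0 ≤ t → t ≤ r → r ≤ s → s ≤ T → V t s = (V t r).comp (V r s)

/-- Strong continuity of a forward family in each variable separately. -/
structure IsStronglyContinuousForward (T : ℝ) (U : ℝ → ℝ → X →L[𝕜] X) : Prop where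
  left : ∀ s ∈ Icc 0 T, ∀ x : X, ContinuousOn (fun t => U t s x) (Icc s T)
  right : ∀ t ∈ Icc 0 T, ∀ x : X, ContinuousOn (fun s => U t s x) (Icc 0 t)

/-- Strong continuity of a backward family in each variable separately. -/
structure IsStronglyContinuousBackward (T : ℝ) (V : ℝ → ℝ → X →L[𝕜] X) : Prop where
  left : ∀ s ∈ Icc 0 T, ∀ x : X, ContinuousOn (fun t => V t s x) (Icc 0 s)
  right : ∀ t ∈ Icc 0 T, ∀ x : X, ContinuousOn (fun s => V t s x) (Icc t T)

/-- Uniform boundedness of a forward family. -/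
def IsUniformlyBoundedForward (T : ℝ) (U : ℝ → ℝ → X →L[𝕜] X) : Prop :=
  ∃ M : ℝ, ∀ s t, 0 ≤ s → s ≤ t → t ≤ T → ‖U t s‖ ≤ M

/-- The family `V t s = (U s t)*` in `L(X*)`. -/
noncomputable def adjointFamily (U : ℝ → ℝ → X →L[𝕜] X) :
    ℝ → ℝ → AntiDual 𝕜 X →L[𝕜] AntiDual 𝕜 X :=
  fun t s => dualAdjoint (U s t)

/-- The adjoints of a forward evolution family form a backward one. -/
theorem IsForwardEvolutionFamily.adjointFamily {T : ℝ} {U : ℝ → ℝ → X →L[𝕜] X}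
    (h : IsForwardEvolutionFamily T U) : IsBackwardEvolutionFamily T (adjointFamily U) where
  refl := fun s hs => by
    ext y x
    simp [_root_.adjointFamily, h.refl s hs]
  comp := fun t r s h0 h1 h2 h3 => by
    ext y x
    simp [_root_.adjointFamily, h.comp t r s h0 h1 h2 h3]

/-- `P ∈ C_s([0,T]; L(X,X*))` solves the backward Riccati integral equation
`P(t) = V(t,T) G U(T,t) + ∫_t^T V(t,r) {C(r) - P(r) B(r) P(r)} U(r,t) dr`, `t ∈ [0,T]`, the integral
being understood in the strong sense, that is, after application to each `x`. -/
structure IsRiccatiSolution (T : ℝ) (U : ℝ → ℝ → X →L[𝕜] X)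
    (V : ℝ → ℝ → AntiDual 𝕜 X →L[𝕜] AntiDual 𝕜 X) (C : ℝ → X →L[𝕜] AntiDual 𝕜 X)
    (B : ℝ → AntiDual 𝕜 X →L[𝕜] X) (G : X →L[𝕜] AntiDual 𝕜 X)
    (P : ℝ → X →L[𝕜] AntiDual 𝕜 X) : Prop where
  stronglyContinuous : StronglyContinuousOp T P
  equation : ∀ t ∈ Icc 0 T, ∀ x : X,
    P t x = V t T (G (U T t x)) +
      ∫ r in t..T, V t r ((C r - (P r).comp ((B r).comp (P r))) (U r t x))

end RiccatiDefs

/-!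
Nonnegativity is not visible in the Riccati equation, whose right-hand side contains `-P B P`. It
becomes visible after discounting. A function `P` with source `F = C - P B P` satisfies
`P(t) = V(t,T) G U(T,t) + ∫ V(t,r) F(r) U(r,t) dr` if and only if, for any constant `c`, it satisfies
`P(t) = e^{-c(T-t)} V(t,T) G U(T,t) + ∫ e^{-c(r-t)} V(t,r) (F(r) + c P(r)) U(r,t) dr`: by the
evolution property both say that, for fixed `t` and `x`, the function `r ↦ V(t,r) P(r) U(r,t) x` has
derivative `-V(t,r) F(r) U(r,t) x` and value `V(t,T) G U(T,t) x` at `T`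
(`IsLyapunovSolution.rediscount`).

Let `W ≥ 0` be the solution with source `C`, and let `c` be at least `‖B‖ ‖W‖` on `[0,T]`. If
`0 ≤ P ≤ W`, then `‖P‖ ≤ ‖W‖` and, by the Cauchy–Schwarz inequality for the form `⟨P x, y⟩`,
`0 ≤ c P - P B P ≤ c W` (`IsNonnegToDual.smul_sub_riccati`, `IsNonnegToDual.riccati`). So the
discounted Picard map, with source `C + c P - P B P`, preserves the order interval `0 ≤ P ≤ W`
(`IsBetweenZeroAnd.exists_next`). On that interval the source is Lipschitz in `P`, and the map is a
contraction in the supremum norm weighted by `e^{κ(T-t)}` (`IsLyapunovSolution.norm_sub_le_half`).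
Its fixed point is a global, nonnegative solution of the Riccati equation, without continuation of
local solutions. The same weighted estimate, for the undiscounted equation, gives uniqueness among
all strongly continuous solutions.
-/

/-! ### Nonnegative self-adjoint operators into the dual -/

section Order

variable {𝕜 : Type*} [RCLike 𝕜] {X : Type*} [NormedAddCommGroup X] [NormedSpace 𝕜 X]

theorem norm_dualAdjoint_apply_le (A : X →L[𝕜] X) (y : AntiDual 𝕜 X) :
    ‖dualAdjoint A y‖ ≤ ‖A‖ * ‖y‖ := by
  refine ContinuousLinearMap.opNorm_le_bound _ (by positivity) fun x => ?_
  calc ‖y (A x)‖ ≤ ‖y‖ * (‖A‖ * ‖x‖) := y.le_opNorm_of_le (A.le_opNorm x)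
    _ = ‖A‖ * ‖y‖ * ‖x‖ := by ring

theorem norm_dualAdjoint_le (A : X →L[𝕜] X) : ‖dualAdjoint A‖ ≤ ‖A‖ :=
  ContinuousLinearMap.opNorm_le_bound _ (norm_nonneg _) (norm_dualAdjoint_apply_le A)

theorem isNonnegToDual_iff {A : X →L[𝕜] AntiDual 𝕜 X} :
    IsNonnegToDual A ↔
      (∀ x y, A x y = starRingEnd 𝕜 (A y x)) ∧ ∀ x, 0 ≤ RCLike.re (A x x) :=
  ⟨fun h => ⟨(isSelfAdjointToDual_iff A).1 h.1, h.2⟩,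
    fun h => ⟨(isSelfAdjointToDual_iff A).2 h.1, h.2⟩⟩

namespace IsNonnegToDual

variable {A A' : X →L[𝕜] AntiDual 𝕜 X}

theorem symm_apply (h : IsNonnegToDual A) (x y : X) : A x y = starRingEnd 𝕜 (A y x) :=
  (isNonnegToDual_iff.1 h).1 x y

theorem zero : IsNonnegToDual (0 : X →L[𝕜] AntiDual 𝕜 X) :=
  isNonnegToDual_iff.2 ⟨by simp, by simp⟩

theorem add (h : IsNonnegToDual A) (h' : IsNonnegToDual A') : IsNonnegToDual (A + A') := by
  refine isNonnegToDual_iff.2 ⟨fun x y => ?_, fun x => ?_⟩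
  · simp [← h.symm_apply x y, ← h'.symm_apply x y]
  · simpa using add_nonneg (h.nonneg x) (h'.nonneg x)

theorem smul (h : IsNonnegToDual A) {c : ℝ} (hc : 0 ≤ c) : IsNonnegToDual (c • A) := by
  refine isNonnegToDual_iff.2 ⟨fun x y => ?_, fun x => ?_⟩
  · simp [RCLike.real_smul_eq_coe_mul, ← h.symm_apply x y]
  · simpa [RCLike.smul_re] using mul_nonneg hc (h.nonneg x)

theorem congruence (h : IsNonnegToDual A) (S : X →L[𝕜] X) :
    IsNonnegToDual ((dualAdjoint S).comp (A.comp S)) :=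
  isNonnegToDual_iff.2 ⟨fun x y => h.symm_apply (S x) (S y), fun x => h.nonneg (S x)⟩

/-- The cone of nonnegative operators is closed. -/
theorem of_tendsto {P : ℕ → X →L[𝕜] AntiDual 𝕜 X} (h : ∀ n, IsNonnegToDual (P n))
    (hP : Filter.Tendsto P Filter.atTop (nhds A)) : IsNonnegToDual A := by
  have key : ∀ x y, Filter.Tendsto (fun n => P n x y) Filter.atTop (nhds (A x y)) := by
    intro x y
    have h1 : Continuous fun L : X →L[𝕜] AntiDual 𝕜 X => L x := by fun_prop
    have h2 : Continuous fun L : AntiDual 𝕜 X => L y := by fun_prop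
    exact ((h2.comp h1).tendsto A).comp hP
  refine isNonnegToDual_iff.2 ⟨fun x y => ?_, fun x => ?_⟩
  · refine tendsto_nhds_unique (key x y) ?_
    simp_rw [fun n => (h n).symm_apply x y]
    exact (RCLike.continuous_conj.tendsto _).comp (key y x)
  · exact ge_of_tendsto' ((RCLike.continuous_re.tendsto _).comp (key x x)) fun n => (h n).nonneg x

/-- The Cauchy–Schwarz inequality for the semidefinite form `⟨A x, y⟩`. -/
theorem norm_apply_apply_sq_le (h : IsNonnegToDual A) (x y : X) :
    ‖A x y‖ ^ 2 ≤ RCLike.re (A x x) * RCLike.re (A y y) := by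
  let _ : PreInnerProductSpace.Core 𝕜 X :=
    { inner := fun x y => A y x
      conj_inner_symm := fun x y => (h.symm_apply y x).symm
      re_inner_nonneg := h.nonneg
      add_left := fun x y z => by simp
      smul_left := fun x y c => by simp }
  have key : ‖A y x‖ * ‖A x y‖ ≤ RCLike.re (A x x) * RCLike.re (A y y) :=
    InnerProductSpace.Core.inner_mul_inner_self_le (𝕜 := 𝕜) x y
  rwa [h.symm_apply y x, RCLike.norm_conj, ← sq] at key

theorem norm_apply_sq_le (h : IsNonnegToDual A) (x : X) :
    ‖A x‖ ^ 2 ≤ ‖A‖ * RCLike.re (A x x) := by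
  have hc : 0 ≤ ‖A‖ * RCLike.re (A x x) := mul_nonneg (norm_nonneg A) (h.nonneg x)
  refine (Real.le_sqrt (norm_nonneg _) hc).1 ?_
  refine ContinuousLinearMap.opNorm_le_bound _ (Real.sqrt_nonneg _) fun y => ?_
  refine (sq_le_sq₀ (norm_nonneg _) (by positivity)).1 ?_
  rw [mul_pow, Real.sq_sqrt hc]
  have hy : RCLike.re (A y y) ≤ ‖A‖ * ‖y‖ * ‖y‖ :=
    (RCLike.re_le_norm _).trans ((A y).le_of_opNorm_le (A.le_opNorm y) y)
  nlinarith [h.norm_apply_apply_sq_le x y, mul_le_mul_of_nonneg_left hy (h.nonneg x)]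

/-- The norm is monotone on nonnegative operators. -/
theorem norm_le_of_sub (h : IsNonnegToDual A) (h' : IsNonnegToDual (A' - A)) : ‖A‖ ≤ ‖A'‖ := by
  have key : ∀ x, ‖A x‖ ^ 2 ≤ ‖A‖ * ‖A'‖ * ‖x‖ ^ 2 := by
    intro x
    have h1 : RCLike.re (A x x) ≤ RCLike.re (A' x x) := by simpa using h'.nonneg x
    have h2 : RCLike.re (A' x x) ≤ ‖A'‖ * ‖x‖ * ‖x‖ :=
      (RCLike.re_le_norm _).trans ((A' x).le_of_opNorm_le (A'.le_opNorm x) x)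
    nlinarith [h.norm_apply_sq_le x, mul_le_mul_of_nonneg_left (h1.trans h2) (norm_nonneg A)]
  have hA : ‖A‖ ≤ √(‖A‖ * ‖A'‖) := by
    refine ContinuousLinearMap.opNorm_le_bound _ (Real.sqrt_nonneg _) fun x => ?_
    refine (sq_le_sq₀ (norm_nonneg _) (by positivity)).1 ?_
    rw [mul_pow, Real.sq_sqrt (by positivity)]
    exact key x
  have hA2 : ‖A‖ * ‖A‖ ≤ ‖A‖ * ‖A'‖ := by
    rw [← sq, ← Real.sq_sqrt (show 0 ≤ ‖A‖ * ‖A'‖ by positivity)]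
    gcongr
  rcases (norm_nonneg A).eq_or_lt with h0 | h0
  · rw [← h0]; positivity
  · exact le_of_mul_le_mul_left hA2 h0

theorem re_riccati_apply {B : AntiDual 𝕜 X →L[𝕜] X} (h : IsNonnegToDual A)
    (x : X) : RCLike.re ((A.comp (B.comp A)) x x) = RCLike.re (A x (B (A x))) := by
  change RCLike.re (A (B (A x)) x) = _
  rw [h.symm_apply, RCLike.conj_re]

theorem riccati_symm_apply {B : AntiDual 𝕜 X →L[𝕜] X} (h : IsNonnegToDual A)
    (hB : IsNonnegFromDual B) (x y : X) :
    (A.comp (B.comp A)) x y = starRingEnd 𝕜 ((A.comp (B.comp A)) y x) := by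
  change A (B (A x)) y = starRingEnd 𝕜 (A (B (A y)) x)
  rw [h.symm_apply (B (A x)) y, h.symm_apply (B (A y)) x,
    (isSelfAdjointFromDual_iff B).1 hB.1]

/-- `P B P ≥ 0`, because `⟨P B P x, x⟩ = ⟨P x, B P x⟩`. -/
theorem riccati {B : AntiDual 𝕜 X →L[𝕜] X} (h : IsNonnegToDual A) (hB : IsNonnegFromDual B) :
    IsNonnegToDual (A.comp (B.comp A)) :=
  isNonnegToDual_iff.2 ⟨h.riccati_symm_apply hB, fun x => by
    rw [h.re_riccati_apply]; exact hB.nonneg (A x)⟩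

/-- The quadratic term is dominated by a multiple of `A`, because
`⟨A B A x, x⟩ ≤ ‖B‖ ‖A x‖² ≤ ‖B‖ ‖A‖ ⟨A x, x⟩`. -/
theorem smul_sub_riccati {B : AntiDual 𝕜 X →L[𝕜] X} (h : IsNonnegToDual A)
    (hB : IsNonnegFromDual B) {c : ℝ} (hc : ‖B‖ * ‖A‖ ≤ c) :
    IsNonnegToDual (c • A - A.comp (B.comp A)) := by
  refine isNonnegToDual_iff.2 ⟨fun x y => ?_, fun x => ?_⟩
  · rw [sub_apply, sub_apply, h.riccati_symm_apply hB,
      sub_apply, sub_apply, map_sub]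
    simp [RCLike.real_smul_eq_coe_mul, ← h.symm_apply x y]
  · rw [sub_apply, sub_apply, map_sub,
      h.re_riccati_apply, smul_apply, smul_apply,
      RCLike.smul_re]
    have h1 : RCLike.re (A x (B (A x))) ≤ ‖A x‖ * (‖B‖ * ‖A x‖) :=
      (RCLike.re_le_norm _).trans ((A x).le_opNorm_of_le (B.le_opNorm _))
    nlinarith [mul_le_mul_of_nonneg_left (h.norm_apply_sq_le x) (norm_nonneg B),
      mul_le_mul_of_nonneg_right hc (h.nonneg x)]

end IsNonnegToDual

theorem norm_riccati_sub_le (A A' : X →L[𝕜] AntiDual 𝕜 X) (B : AntiDual 𝕜 X →L[𝕜] X) :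
    ‖A.comp (B.comp A) - A'.comp (B.comp A')‖ ≤ (‖A‖ + ‖A'‖) * ‖B‖ * ‖A - A'‖ := by
  have : A.comp (B.comp A) - A'.comp (B.comp A') =
      (A - A').comp (B.comp A) + A'.comp (B.comp (A - A')) := by
    ext x y; simp
  rw [this]
  have h1 : ‖(A - A').comp (B.comp A)‖ ≤ ‖A - A'‖ * (‖B‖ * ‖A‖) :=
    (ContinuousLinearMap.opNorm_comp_le _ _).trans
      (mul_le_mul_of_nonneg_left (ContinuousLinearMap.opNorm_comp_le _ _) (norm_nonneg _))
  have h2 : ‖A'.comp (B.comp (A - A'))‖ ≤ ‖A'‖ * (‖B‖ * ‖A - A'‖) :=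
    (ContinuousLinearMap.opNorm_comp_le _ _).trans
      (mul_le_mul_of_nonneg_left (ContinuousLinearMap.opNorm_comp_le _ _) (norm_nonneg _))
  linarith [norm_add_le ((A - A').comp (B.comp A)) (A'.comp (B.comp (A - A')))]

end Order

/-! ### Strongly continuous operator functions -/

section StrongContinuity

variable {𝕜 : Type*} [RCLike 𝕜] {X Y Z : Type*}
  [NormedAddCommGroup X] [NormedSpace 𝕜 X] [NormedAddCommGroup Y] [NormedSpace 𝕜 Y]
  [NormedAddCommGroup Z] [NormedSpace 𝕜 Z]

/-- A bounded strongly continuous operator function applied to a continuous function is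
continuous. -/
theorem ContinuousWithinAt.clm_apply_of_bound {s : Set ℝ} {A : ℝ → Y →L[𝕜] Z} {f : ℝ → Y} {M r : ℝ}
    (hA : ContinuousWithinAt (fun t => A t (f r)) s r) (hM : ∀ t ∈ s, ‖A t‖ ≤ M)
    (hf : ContinuousWithinAt f s r) : ContinuousWithinAt (fun t => A t (f t)) s r := by
  have h1 : Filter.Tendsto (fun t => M * ‖f t - f r‖) (nhdsWithin r s) (nhds 0) := by
    have := ((hf.sub (continuousWithinAt_const (b := f r))).norm.const_mul M).tendsto
    simpa using this
  have h2 : Filter.Tendsto (fun t => A t (f t - f r)) (nhdsWithin r s) (nhds 0) := by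
    refine squeeze_zero_norm' ?_ h1
    filter_upwards [self_mem_nhdsWithin] with t ht
    exact (A t).le_of_opNorm_le (hM t ht) _
  have h3 := h2.add hA.tendsto
  refine (h3.congr fun t => ?_).trans (by simp)
  simp

theorem ContinuousOn.clm_apply_of_bound {s : Set ℝ} {A : ℝ → Y →L[𝕜] Z} {f : ℝ → Y} {M : ℝ}
    (hA : ∀ y, ContinuousOn (fun t => A t y) s) (hM : ∀ t ∈ s, ‖A t‖ ≤ M)
    (hf : ContinuousOn f s) : ContinuousOn (fun t => A t (f t)) s :=
  fun r hr => ContinuousWithinAt.clm_apply_of_bound (hA _ r hr) hM (hf r hr)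

namespace StronglyContinuousOp

variable {T : ℝ}

/-- Uniform boundedness principle on the compact interval. -/
theorem exists_bound [CompleteSpace X] {P : ℝ → X →L[𝕜] Y} (hP : StronglyContinuousOp T P) :
    ∃ M, 0 ≤ M ∧ ∀ t ∈ Icc 0 T, ‖P t‖ ≤ M := by
  obtain ⟨M, hM⟩ := banach_steinhaus (g := fun t : Icc 0 T => P t) fun x => by
    obtain ⟨c, hc⟩ := isCompact_Icc.exists_bound_of_continuousOn (hP x)
    exact ⟨c, fun t => hc t t.2⟩
  exact ⟨max M 0, le_max_right _ _, fun t ht => (hM ⟨t, ht⟩).trans (le_max_left _ _)⟩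

theorem comp [CompleteSpace Y] {P : ℝ → Y →L[𝕜] Z} {Q : ℝ → X →L[𝕜] Y}
    (hP : StronglyContinuousOp T P) (hQ : StronglyContinuousOp T Q) :
    StronglyContinuousOp T fun t => (P t).comp (Q t) := by
  obtain ⟨M, -, hM⟩ := hP.exists_bound
  exact fun x => ContinuousOn.clm_apply_of_bound (A := P) hP hM (hQ x)

theorem add {P Q : ℝ → X →L[𝕜] Y} (hP : StronglyContinuousOp T P)
    (hQ : StronglyContinuousOp T Q) : StronglyContinuousOp T fun t => P t + Q t :=
  fun x => (hP x).add (hQ x)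

theorem sub {P Q : ℝ → X →L[𝕜] Y} (hP : StronglyContinuousOp T P)
    (hQ : StronglyContinuousOp T Q) : StronglyContinuousOp T fun t => P t - Q t :=
  fun x => (hP x).sub (hQ x)

theorem const_smul {P : ℝ → X →L[𝕜] AntiDual 𝕜 X} (hP : StronglyContinuousOp T P) (c : ℝ) :
    StronglyContinuousOp T fun t => c • P t :=
  fun x => (hP x).const_smul c

end StronglyContinuousOp

end StrongContinuity

/-! ### Discounted Lyapunov equations -/

section Lyapunov

variable {𝕜 : Type*} [RCLike 𝕜] {X : Type*} [NormedAddCommGroup X] [NormedSpace 𝕜 X]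

/-- The standing assumptions on the evolution family, with an explicit bound `M`. -/
structure IsBoundedEvolution (T : ℝ) (U : ℝ → ℝ → X →L[𝕜] X) (M : ℝ) : Prop where
  family : IsForwardEvolutionFamily T U
  cont : IsStronglyContinuousForward T U
  adjoint_cont : IsStronglyContinuousBackward T (adjointFamily U)
  bound : ∀ s t, 0 ≤ s → s ≤ t → t ≤ T → ‖U t s‖ ≤ M

/-- `P` solves the Lyapunov equation with source `H`, terminal value `G` and discount rate `c`:
`P(t) = e^{-c(T-t)} V(t,T) G U(T,t) + ∫_t^T e^{-c(r-t)} V(t,r) H(r) U(r,t) dr` strongly on `[0,T]`,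
where `V(t,r) = U(r,t)*`. -/
def IsLyapunovSolution (T : ℝ) (U : ℝ → ℝ → X →L[𝕜] X) (c : ℝ) (G : X →L[𝕜] AntiDual 𝕜 X)
    (H P : ℝ → X →L[𝕜] AntiDual 𝕜 X) : Prop :=
  ∀ t ∈ Icc 0 T, ∀ x : X,
    P t x = Real.exp (-c * (T - t)) • dualAdjoint (U T t) (G (U T t x)) +
      ∫ r in t..T, Real.exp (-c * (r - t)) • dualAdjoint (U r t) (H r (U r t x))

variable {T M : ℝ} {U : ℝ → ℝ → X →L[𝕜] X} {c : ℝ} {G : X →L[𝕜] AntiDual 𝕜 X}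
  {H P : ℝ → X →L[𝕜] AntiDual 𝕜 X}

namespace IsBoundedEvolution

theorem nonneg (hU : IsBoundedEvolution T U M) (hT : 0 ≤ T) : 0 ≤ M :=
  (norm_nonneg _).trans (hU.bound 0 0 le_rfl le_rfl hT)

theorem norm_conj_apply_le (hU : IsBoundedEvolution T U M) (hT : 0 ≤ T) {t r : ℝ}
    (ht : 0 ≤ t) (htr : t ≤ r) (hr : r ≤ T)
    (S : X →L[𝕜] AntiDual 𝕜 X) (x : X) :
    ‖dualAdjoint (U r t) (S (U r t x))‖ ≤ M ^ 2 * ‖S‖ * ‖x‖ := by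
  have hM := hU.nonneg hT
  have hb := hU.bound t r ht htr hr
  calc _ ≤ ‖U r t‖ * ‖S (U r t x)‖ := norm_dualAdjoint_apply_le _ _
    _ ≤ M * (‖S‖ * (M * ‖x‖)) := by
        gcongr
        exact (S.le_opNorm _).trans (by gcongr; exact (U r t).le_of_opNorm_le hb x)
    _ = _ := by ring

theorem continuousOn_integrand [CompleteSpace X] (hU : IsBoundedEvolution T U M)
    (hH : StronglyContinuousOp T H) (c : ℝ) {t : ℝ} (ht : t ∈ Icc 0 T) (x : X) :
    ContinuousOn (fun r => Real.exp (-c * (r - t)) • dualAdjoint (U r t) (H r (U r t x)))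
      (Icc t T) := by
  have hsub : Icc t T ⊆ Icc 0 T := Icc_subset_Icc_left ht.1
  obtain ⟨K, -, hK⟩ := hH.exists_bound
  have h1 : ContinuousOn (fun r => H r (U r t x)) (Icc t T) :=
    ContinuousOn.clm_apply_of_bound (fun y => (hH y).mono hsub) (fun r hr => hK r (hsub hr))
      (hU.cont.left t ht x)
  have h2 : ContinuousOn (fun r => dualAdjoint (U r t) (H r (U r t x))) (Icc t T) :=
    ContinuousOn.clm_apply_of_bound (A := fun r => dualAdjoint (U r t))
      (fun y => hU.adjoint_cont.right t ht y)
      (fun r hr => (norm_dualAdjoint_le _).trans (hU.bound t r ht.1 hr.1 hr.2)) h1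
  have h3 : ContinuousOn (fun r => Real.exp (-c * (r - t))) (Icc t T) := by fun_prop
  exact h3.smul h2

theorem intervalIntegrable [CompleteSpace X] (hU : IsBoundedEvolution T U M)
    (hH : StronglyContinuousOp T H) (c : ℝ) {t : ℝ} (ht : t ∈ Icc 0 T) (x : X) :
    IntervalIntegrable (fun r => Real.exp (-c * (r - t)) • dualAdjoint (U r t) (H r (U r t x)))
      MeasureTheory.volume t T :=
  (hU.continuousOn_integrand hH c ht x).intervalIntegrable_of_Icc ht.2

theorem continuousWithinAt_conj [CompleteSpace X] (hU : IsBoundedEvolution T U M)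
    (S : X →L[𝕜] AntiDual 𝕜 X) {t r : ℝ} (hr : r ∈ Icc 0 T) (ht : t ∈ Icc 0 r) (x : X) :
    ContinuousWithinAt (fun t => dualAdjoint (U r t) (S (U r t x))) (Icc 0 r) t :=
  ContinuousOn.clm_apply_of_bound (A := fun t => dualAdjoint (U r t))
      (fun y => hU.adjoint_cont.left r hr y)
      (fun s hs => (norm_dualAdjoint_le _).trans (hU.bound s r hs.1 hs.2 hr.2))
      (S.continuous.comp_continuousOn (hU.cont.right r hr x)) t ht

/-- The integrand is only separately continuous, and it is defined only for `t ≤ r`. Extended by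
zero, it is continuous in `t` at `t₀` for each `r ≠ t₀`, and dominated convergence applies. -/
theorem continuousOn_integral [CompleteSpace X] (hU : IsBoundedEvolution T U M)
    (hH : StronglyContinuousOp T H) (c : ℝ) (x : X) :
    ContinuousOn (fun t => ∫ r in t..T,
      Real.exp (-c * (r - t)) • dualAdjoint (U r t) (H r (U r t x))) (Icc 0 T) := by
  intro t₀ ht₀
  have hT : 0 ≤ T := ht₀.1.trans ht₀.2
  obtain ⟨K, hK0, hK⟩ := hH.exists_bound
  set f : ℝ → ℝ → AntiDual 𝕜 X :=
    fun t r => Real.exp (-c * (r - t)) • dualAdjoint (U r t) (H r (U r t x))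
  have heq : ∀ t ∈ Icc 0 T, ∫ r in t..T, f t r = ∫ r, (Ioc t T).indicator (f t) r := by
    intro t ht
    rw [intervalIntegral.integral_of_le ht.2, MeasureTheory.integral_indicator measurableSet_Ioc]
  refine ContinuousWithinAt.congr ?_ heq (heq t₀ ht₀)
  have hM := hU.nonneg hT
  refine MeasureTheory.continuousWithinAt_of_dominated
    (bound := (Ioc 0 T).indicator fun _ => Real.exp (|c| * T) * (M ^ 2 * K * ‖x‖)) ?_ ?_ ?_ ?_
  · filter_upwards [self_mem_nhdsWithin] with t ht
    rw [aestronglyMeasurable_indicator_iff measurableSet_Ioc]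
    exact ((hU.continuousOn_integrand hH c ht x).mono Ioc_subset_Icc_self).aestronglyMeasurable
      measurableSet_Ioc
  · filter_upwards [self_mem_nhdsWithin] with t ht
    refine Filter.Eventually.of_forall fun r => ?_
    by_cases hr : r ∈ Ioc t T
    · have hr' : r ∈ Ioc 0 T := ⟨ht.1.trans_lt hr.1, hr.2⟩
      rw [indicator_of_mem hr, indicator_of_mem hr', norm_smul, Real.norm_eq_abs, Real.abs_exp]
      have hexp : -c * (r - t) ≤ |c| * T :=
        (mul_le_mul_of_nonneg_right (neg_le_abs c) (by linarith [hr.1])).trans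
          (mul_le_mul_of_nonneg_left (by linarith [hr.2, ht.1]) (abs_nonneg c))
      have h1 := hU.norm_conj_apply_le hT ht.1 hr.1.le hr.2 (H r) x
      have h2 : M ^ 2 * ‖H r‖ * ‖x‖ ≤ M ^ 2 * K * ‖x‖ := by
        have := hK r ⟨hr'.1.le, hr'.2⟩
        gcongr
      gcongr
      exact h1.trans h2
    · rw [indicator_of_notMem hr, norm_zero]
      exact indicator_nonneg (fun _ _ => by positivity) _
  · rw [MeasureTheory.integrable_indicator_iff measurableSet_Ioc]
    exact MeasureTheory.integrableOn_const (by simp)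
  · have hne : ∀ᵐ r : ℝ, r ≠ t₀ := by
      simp [MeasureTheory.ae_iff]
    filter_upwards [hne] with r hr
    by_cases hrT : r ∈ Icc 0 T
    swap
    · have h0 : ∀ t ∈ Icc 0 T, (Ioc t T).indicator (f t) r = 0 := fun t ht =>
        indicator_of_notMem (fun h => hrT ⟨ht.1.trans h.1.le, h.2⟩) _
      exact continuousWithinAt_const.congr h0 (h0 t₀ ht₀)
    rcases lt_or_gt_of_ne hr with h | h
    · refine (continuousWithinAt_const (b := (0 : AntiDual 𝕜 X))).congr_of_eventuallyEq ?_ ?_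
      · filter_upwards [mem_nhdsWithin_of_mem_nhds (Ioi_mem_nhds h)] with t ht
        exact indicator_of_notMem (fun h' => lt_asymm h'.1 ht) _
      · exact indicator_of_notMem (fun h' => lt_asymm h'.1 h) _
    · have h0 : ContinuousWithinAt (fun t => Real.exp (-c * (r - t))) (Icc 0 r) t₀ := by
        fun_prop
      have h1 : ContinuousWithinAt (fun t => f t r) (Icc 0 r) t₀ :=
        h0.smul (hU.continuousWithinAt_conj (H r) hrT ⟨ht₀.1, h.le⟩ x)
      have h2 : ContinuousWithinAt (fun t => f t r) (Icc 0 T) t₀ := by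
        refine h1.mono_of_mem_nhdsWithin ?_
        filter_upwards [self_mem_nhdsWithin, mem_nhdsWithin_of_mem_nhds (Iio_mem_nhds h)]
          with t ht ht'
        exact ⟨ht.1, ht'.le⟩
      refine h2.congr_of_eventuallyEq ?_ (indicator_of_mem (show r ∈ Ioc t₀ T from ⟨h, hrT.2⟩) _)
      filter_upwards [mem_nhdsWithin_of_mem_nhds (Iio_mem_nhds h)] with t ht
      exact indicator_of_mem (show r ∈ Ioc t T from ⟨ht, hrT.2⟩) _

/-- The weight `e^{κ(T-t)}` gains the factor `1 / κ` under integration from `t` to `T`. -/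
theorem norm_integral_le (hU : IsBoundedEvolution T U M) (hc : 0 ≤ c)
    {κ a : ℝ} (hκ : 0 < κ) (ha : 0 ≤ a)
    (hH : ∀ r ∈ Icc 0 T, ‖H r‖ ≤ a * Real.exp (κ * (T - r))) {t : ℝ} (ht : t ∈ Icc 0 T) (x : X) :
    ‖∫ r in t..T, Real.exp (-c * (r - t)) • dualAdjoint (U r t) (H r (U r t x))‖ ≤
      M ^ 2 * a / κ * Real.exp (κ * (T - t)) * ‖x‖ := by
  have hT : 0 ≤ T := ht.1.trans ht.2
  have hderiv : ∀ r ∈ uIcc t T,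
      HasDerivAt (fun r => -(M ^ 2 * a / κ * ‖x‖) * Real.exp (κ * (T - r)))
        (M ^ 2 * (a * Real.exp (κ * (T - r))) * ‖x‖) r := by
    intro r _
    have h1 : HasDerivAt (fun r => κ * (T - r)) (κ * (-1)) r :=
      ((hasDerivAt_id r).const_sub T).const_mul κ
    refine (h1.exp.const_mul (-(M ^ 2 * a / κ * ‖x‖))).congr_deriv ?_
    field_simp
  have hint : IntervalIntegrable (fun r => M ^ 2 * (a * Real.exp (κ * (T - r))) * ‖x‖)
      MeasureTheory.volume t T := Continuous.intervalIntegrable (by fun_prop) _ _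
  refine (intervalIntegral.norm_integral_le_of_norm_le ht.2
    (Filter.Eventually.of_forall fun r hr => ?_) hint).trans ?_
  · have hr' : r ∈ Icc 0 T := ⟨ht.1.trans hr.1.le, hr.2⟩
    rw [norm_smul, Real.norm_eq_abs, Real.abs_exp]
    have hexp : Real.exp (-c * (r - t)) ≤ 1 :=
      Real.exp_le_one_iff.2 (by nlinarith [hr.1])
    have h1 := hU.norm_conj_apply_le hT ht.1 hr.1.le hr.2 (H r) x
    have h2 : M ^ 2 * ‖H r‖ * ‖x‖ ≤ M ^ 2 * (a * Real.exp (κ * (T - r))) * ‖x‖ := by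
      have := hH r hr'
      gcongr
    exact (mul_le_of_le_one_left (norm_nonneg _) hexp).trans (h1.trans h2)
  · rw [intervalIntegral.integral_eq_sub_of_hasDerivAt hderiv hint]
    have : 0 ≤ M ^ 2 * a / κ * ‖x‖ := by positivity
    simp only [sub_self, mul_zero, Real.exp_zero]
    linarith

/-- The Lyapunov integrals define bounded operators, and these depend strongly continuously on
`t`. -/
theorem exists_isLyapunovSolution [CompleteSpace X] (hU : IsBoundedEvolution T U M)
    (hT : 0 ≤ T) (hH : StronglyContinuousOp T H) (hc : 0 ≤ c) (G : X →L[𝕜] AntiDual 𝕜 X) :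
    ∃ P, StronglyContinuousOp T P ∧ IsLyapunovSolution T U c G H P := by
  obtain ⟨K, hK0, hK⟩ := hH.exists_bound
  have hpt : ∀ t, ∃ Q : X →L[𝕜] AntiDual 𝕜 X, t ∈ Icc 0 T → ∀ x, Q x =
      ∫ r in t..T, Real.exp (-c * (r - t)) • dualAdjoint (U r t) (H r (U r t x)) := by
    intro t
    by_cases ht : t ∈ Icc 0 T
    swap
    · exact ⟨0, fun h => absurd h ht⟩
    refine ⟨LinearMap.mkContinuous
      { toFun := fun x =>
          ∫ r in t..T, Real.exp (-c * (r - t)) • dualAdjoint (U r t) (H r (U r t x))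
        map_add' := fun x y => ?_
        map_smul' := fun k x => ?_ } (M ^ 2 * K / 1 * Real.exp (1 * (T - t))) fun x => ?_,
      fun _ x => rfl⟩
    · simp only [map_add, smul_add]
      exact intervalIntegral.integral_add (hU.intervalIntegrable hH c ht x)
        (hU.intervalIntegrable hH c ht y)
    · simp only [map_smul, RingHom.id_apply]
      rw [← intervalIntegral.integral_smul]
      refine intervalIntegral.integral_congr fun r _ => ?_
      exact smul_comm _ _ _
    -- The weighted estimate with `κ = 1` applies, since the weight is at least one.
    · refine hU.norm_integral_le hc one_pos hK0 (fun r hr => ?_) ht x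
      refine (hK r hr).trans (le_mul_of_one_le_right hK0 (Real.one_le_exp ?_))
      linarith [hr.2]
  choose Q hQ using hpt
  refine ⟨fun t => Real.exp (-c * (T - t)) • (dualAdjoint (U T t)).comp (G.comp (U T t)) + Q t,
    fun x => ?_, fun t ht x => ?_⟩
  · refine ContinuousOn.add ?_ ((hU.continuousOn_integral hH c x).congr fun t ht => hQ t ht x)
    exact ContinuousOn.smul (f := fun t => Real.exp (-c * (T - t)))
      (g := fun t => dualAdjoint (U T t) (G (U T t x))) (by fun_prop) fun t ht =>
      hU.continuousWithinAt_conj G ⟨hT, le_rfl⟩ ht x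
  · rw [← hQ t ht x]; rfl

end IsBoundedEvolution

namespace IsLyapunovSolution

theorem sub [CompleteSpace X] (hU : IsBoundedEvolution T U M) {G' : X →L[𝕜] AntiDual 𝕜 X}
    {H' P' : ℝ → X →L[𝕜] AntiDual 𝕜 X} (hH : StronglyContinuousOp T H)
    (hH' : StronglyContinuousOp T H') (h : IsLyapunovSolution T U c G H P)
    (h' : IsLyapunovSolution T U c G' H' P') :
    IsLyapunovSolution T U c (G - G') (fun t => H t - H' t) (fun t => P t - P' t) := by
  intro t ht x
  simp only [sub_apply, h t ht x, h' t ht x, map_sub, smul_sub]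
  rw [intervalIntegral.integral_sub (hU.intervalIntegrable hH c ht x)
    (hU.intervalIntegrable hH' c ht x)]
  abel

theorem norm_le (hU : IsBoundedEvolution T U M) (hc : 0 ≤ c)
    (h : IsLyapunovSolution T U c 0 H P) {κ a : ℝ} (hκ : 0 < κ) (ha : 0 ≤ a)
    (hH : ∀ r ∈ Icc 0 T, ‖H r‖ ≤ a * Real.exp (κ * (T - r))) {t : ℝ} (ht : t ∈ Icc 0 T) :
    ‖P t‖ ≤ M ^ 2 * a / κ * Real.exp (κ * (T - t)) := by
  refine ContinuousLinearMap.opNorm_le_bound _ (by positivity) fun x => ?_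
  rw [h t ht x]
  have h0 : Real.exp (-c * (T - t)) •
      dualAdjoint (U T t) ((0 : X →L[𝕜] AntiDual 𝕜 X) (U T t x)) = 0 := by
    ext y
    exact smul_zero (Real.exp (-c * (T - t)))
  rw [h0, zero_add]
  exact hU.norm_integral_le hc hκ ha hH ht x

theorem isNonnegToDual [CompleteSpace X] (hU : IsBoundedEvolution T U M)
    (hcont : StronglyContinuousOp T H) (h : IsLyapunovSolution T U c G H P)
    (hG : IsNonnegToDual G) (hH : ∀ t ∈ Icc 0 T, IsNonnegToDual (H t)) {t : ℝ}
    (ht : t ∈ Icc 0 T) : IsNonnegToDual (P t) := by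
  have happ : ∀ x y : X, P t x y =
      (Real.exp (-c * (T - t)) • (dualAdjoint (U T t)).comp (G.comp (U T t))) x y +
        ∫ r in t..T, (Real.exp (-c * (r - t)) •
          (dualAdjoint (U r t)).comp ((H r).comp (U r t))) x y := by
    intro x y
    rw [h t ht x, add_apply]
    congr 1
    exact ((ContinuousLinearMap.apply' 𝕜 (starRingEnd 𝕜) y).intervalIntegral_comp_comm
      (hU.intervalIntegrable hcont c ht x)).symm
  have hint : ∀ x, IntervalIntegrable (fun r => (Real.exp (-c * (r - t)) •
      (dualAdjoint (U r t)).comp ((H r).comp (U r t))) x x) MeasureTheory.volume t T := fun x =>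
    (((ContinuousLinearMap.apply' 𝕜 (starRingEnd 𝕜) x).continuous.comp_continuousOn
      (hU.continuousOn_integrand hcont c ht x))).intervalIntegrable_of_Icc ht.2
  have hterm := (hG.congruence (U T t)).smul (Real.exp_nonneg (-c * (T - t)))
  have hsrc : ∀ r ∈ Icc t T, IsNonnegToDual (Real.exp (-c * (r - t)) •
      (dualAdjoint (U r t)).comp ((H r).comp (U r t))) := fun r hr =>
    ((hH r ⟨ht.1.trans hr.1, hr.2⟩).congruence (U r t)).smul (Real.exp_nonneg _)
  refine isNonnegToDual_iff.2 ⟨fun x y => ?_, fun x => ?_⟩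
  · rw [happ x y, happ y x, map_add, ← hterm.symm_apply, ← intervalIntegral.intervalIntegral_conj]
    congr 1
    refine intervalIntegral.integral_congr fun r hr => ?_
    rw [uIcc_of_le ht.2] at hr
    exact (hsrc r hr).symm_apply x y
  · rw [happ x x, map_add, ← intervalIntegral.intervalIntegral_re (hint x)]
    exact add_nonneg (hterm.nonneg x)
      (intervalIntegral.integral_nonneg ht.2 fun r hr => (hsrc r hr).nonneg x)

end IsLyapunovSolution

end Lyapunov

/-! ### Changing the discount rate -/

section Rediscounting

/-- Changing the discount rate in a Volterra equation from `c` to `m` adds `(m - c) g` to the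
source: both equations say that `g' = c g - f` and `g(T) = v`. -/
theorem rediscount {E : Type*} [NormedAddCommGroup E] [NormedSpace ℝ E] [CompleteSpace E]
    {t T : ℝ} (htT : t ≤ T) {f g : ℝ → E} (hf : ContinuousOn f (Icc t T)) {c : ℝ} {v : E}
    (hg : ∀ r ∈ Icc t T,
      g r = Real.exp (-c * (T - r)) • v + ∫ s in r..T, Real.exp (-c * (s - r)) • f s) (m : ℝ) :
    g t = Real.exp (-m * (T - t)) • v +
      ∫ r in t..T, Real.exp (-m * (r - t)) • (f r + (m - c) • g r) := by
  set F : ℝ → E := fun s => Real.exp (-c * s) • f s with hF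
  -- `g(r) = e^{cr} (e^{-cT} v + J(r))` with a primitive `J`, so `e^{-mr} g(r)` is differentiable.
  set J : ℝ → E := fun r => ∫ s in r..T, F s with hJ
  have hFc : ContinuousOn F (Icc t T) :=
    ContinuousOn.smul (f := fun s => Real.exp (-c * s)) (by fun_prop) hf
  have hFi : ∀ r ∈ Icc t T, IntervalIntegrable F MeasureTheory.volume r T := fun r hr =>
    (hFc.mono (Icc_subset_Icc_left hr.1)).intervalIntegrable_of_Icc hr.2
  have hgJ : ∀ r ∈ Icc t T, g r = Real.exp (c * r) • (Real.exp (-c * T) • v + J r) := by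
    intro r hr
    rw [hg r hr, smul_add, smul_smul, ← Real.exp_add, hJ, ← intervalIntegral.integral_smul]
    congr 1
    · ring_nf
    · refine intervalIntegral.integral_congr fun s _ => ?_
      simp only [hF, smul_smul, ← Real.exp_add]
      ring_nf
  have hJc : ContinuousOn J (Icc t T) := by
    have := intervalIntegral.continuousOn_primitive_interval_left
      (f := F) (μ := MeasureTheory.volume) (a := t) (b := T)
      (by rw [uIcc_of_le htT]; exact hFc.integrableOn_Icc)
    rwa [uIcc_of_le htT] at this
  have hgc : ContinuousOn g (Icc t T) :=
    (ContinuousOn.smul (f := fun r => Real.exp (c * r)) (by fun_prop)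
      (continuousOn_const.add hJc)).congr hgJ
  have hsrc : ContinuousOn (fun r => Real.exp (-m * r) • (f r + (m - c) • g r)) (Icc t T) :=
    ContinuousOn.smul (f := fun r => Real.exp (-m * r)) (by fun_prop)
      (hf.add (hgc.const_smul (m - c)))
  have hkc : ContinuousOn (fun r => Real.exp (-m * r) • g r) (Icc t T) :=
    ContinuousOn.smul (f := fun r => Real.exp (-m * r)) (by fun_prop) hgc
  have hderiv : ∀ r ∈ Ioo t T, HasDerivAt (fun r => Real.exp (-m * r) • g r)
      (-(Real.exp (-m * r) • (f r + (m - c) • g r))) r := by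
    intro r hr
    have hr' : r ∈ Icc t T := Ioo_subset_Icc_self hr
    have hJ' : HasDerivAt J (-F r) r := by
      refine intervalIntegral.integral_hasDerivAt_left (hFi r hr') ?_
        (hFc.continuousAt (Icc_mem_nhds hr.1 hr.2))
      exact (hFc.mono Ioo_subset_Icc_self).stronglyMeasurableAtFilter isOpen_Ioo r hr
    have hexp : HasDerivAt (fun r => Real.exp ((c - m) * r))
        (Real.exp ((c - m) * r) * ((c - m) * 1)) r := ((hasDerivAt_id r).const_mul (c - m)).exp
    have hk := hexp.smul (hJ'.const_add (Real.exp (-c * T) • v))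
    refine (hk.congr_of_eventuallyEq ?_).congr_deriv ?_
    · filter_upwards [Icc_mem_nhds hr.1 hr.2] with s hs
      rw [hgJ s hs, smul_smul, ← Real.exp_add]
      simp only [Pi.smul_apply']
      ring_nf
    · rw [hgJ r hr', hF]
      have e1 : Real.exp ((c - m) * r) = Real.exp (-m * r) * Real.exp (c * r) := by
        rw [← Real.exp_add]; ring_nf
      have e2 : Real.exp (-c * r) = (Real.exp (c * r))⁻¹ := by
        rw [← Real.exp_neg]; ring_nf
      have e3 := Real.exp_ne_zero (c * r)
      simp only [e1, e2]
      match_scalars <;> field_simp <;> ring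
  have hftc := intervalIntegral.integral_eq_sub_of_hasDerivAt_of_le htT hkc hderiv
    (hsrc.neg.intervalIntegrable_of_Icc htT)
  have hgT : g T = v := by
    have := hg T ⟨htT, le_rfl⟩
    simpa using this
  rw [intervalIntegral.integral_neg, hgT] at hftc
  have hpull : ∫ r in t..T, Real.exp (-m * (r - t)) • (f r + (m - c) • g r) =
      Real.exp (m * t) • ∫ r in t..T, Real.exp (-m * r) • (f r + (m - c) • g r) := by
    rw [← intervalIntegral.integral_smul]
    refine intervalIntegral.integral_congr fun r _ => ?_
    simp only [smul_smul, ← Real.exp_add]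
    ring_nf
  have hsolve : ∫ r in t..T, Real.exp (-m * r) • (f r + (m - c) • g r) =
      Real.exp (-m * t) • g t - Real.exp (-m * T) • v := by
    rw [← neg_inj, hftc]; abel
  rw [hpull, hsolve, smul_sub, smul_smul, smul_smul, ← Real.exp_add, ← Real.exp_add]
  have e1 : m * t + -m * t = 0 := by ring
  have e2 : -m * (T - t) = m * t + -m * T := by ring
  rw [e1, e2, Real.exp_zero, one_smul]
  abel

variable {𝕜 : Type*} [RCLike 𝕜] {X : Type*} [NormedAddCommGroup X] [NormedSpace 𝕜 X]
  [CompleteSpace X] {T M : ℝ} {U : ℝ → ℝ → X →L[𝕜] X} {c : ℝ} {G : X →L[𝕜] AntiDual 𝕜 X}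
  {H P : ℝ → X →L[𝕜] AntiDual 𝕜 X}

/-- Along the evolution, `r ↦ V(t,r) P(r) U(r,t) x` solves a Volterra equation without evolution
operators, to which `rediscount` applies. -/
theorem IsLyapunovSolution.rediscount (hU : IsBoundedEvolution T U M)
    (hH : StronglyContinuousOp T H) (h : IsLyapunovSolution T U c G H P) (m : ℝ) :
    IsLyapunovSolution T U m G (fun t => H t + (m - c) • P t) P := by
  intro t ht x
  have hcomp : ∀ r s, t ≤ r → r ≤ s → s ≤ T → U s t = (U s r).comp (U r t) :=
    fun r s h1 h2 h3 => hU.family.comp t r s ht.1 h1 h2 h3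
  have hf : ContinuousOn (fun r => dualAdjoint (U r t) (H r (U r t x))) (Icc t T) := by
    simpa using hU.continuousOn_integrand hH 0 ht x
  have key := _root_.rediscount ht.2 (g := fun r => dualAdjoint (U r t) (P r (U r t x)))
    (v := dualAdjoint (U T t) (G (U T t x))) (c := c) hf (fun r hr => ?_) m
  · have hid := hU.family.refl t ht
    have hPt : dualAdjoint (U t t) (P t (U t t x)) = P t x := by
      ext y
      simp [hid]
    rw [← hPt, key]
    rfl
  · have hr0 : r ∈ Icc 0 T := ⟨ht.1.trans hr.1, hr.2⟩
    rw [h r hr0, map_add, ← (dualAdjoint (U r t)).intervalIntegral_comp_comm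
      (hU.intervalIntegrable hH c hr0 _)]
    congr 1
    · rw [hcomp r T hr.1 hr.2 le_rfl]
      rfl
    · refine intervalIntegral.integral_congr fun s hs => ?_
      rw [uIcc_of_le hr.2] at hs
      ext y
      simp [hcomp r s hr.1 hs.1 hs.2]

end Rediscounting

/-! ### The Riccati equation -/

section Riccati

variable {𝕜 : Type*} [RCLike 𝕜] {X : Type*} [NormedAddCommGroup X] [NormedSpace 𝕜 X]
  {T M : ℝ} {U : ℝ → ℝ → X →L[𝕜] X} {c : ℝ} {G : X →L[𝕜] AntiDual 𝕜 X}
  {C P Q : ℝ → X →L[𝕜] AntiDual 𝕜 X} {B : ℝ → AntiDual 𝕜 X →L[𝕜] X}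

theorem isRiccatiSolution_iff :
    IsRiccatiSolution T U (adjointFamily U) C B G P ↔ StronglyContinuousOp T P ∧
      IsLyapunovSolution T U 0 G (fun t => C t - (P t).comp ((B t).comp (P t))) P := by
  refine ⟨fun h => ⟨h.1, fun t ht x => ?_⟩, fun h => ⟨h.1, fun t ht x => ?_⟩⟩
  · simpa [adjointFamily] using h.2 t ht x
  · simpa [adjointFamily] using h.2 t ht x

/-- The source `C + c P - P B P` of the Riccati equation discounted at rate `c`. -/
noncomputable def riccatiSource (c : ℝ) (C : ℝ → X →L[𝕜] AntiDual 𝕜 X)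
    (B : ℝ → AntiDual 𝕜 X →L[𝕜] X) (P : ℝ → X →L[𝕜] AntiDual 𝕜 X) (t : ℝ) :
    X →L[𝕜] AntiDual 𝕜 X :=
  C t + (c • P t - (P t).comp ((B t).comp (P t)))

theorem norm_riccatiSource_sub_le {b R : ℝ} (hR : 0 ≤ R) (hc : 0 ≤ c) {t : ℝ}
    (hBt : ‖B t‖ ≤ b) (hPt : ‖P t‖ ≤ R) (hQt : ‖Q t‖ ≤ R) :
    ‖riccatiSource c C B P t - riccatiSource c C B Q t‖ ≤ (c + 2 * R * b) * ‖P t - Q t‖ := by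
  have heq : riccatiSource c C B P t - riccatiSource c C B Q t =
      c • (P t - Q t) - ((P t).comp ((B t).comp (P t)) - (Q t).comp ((B t).comp (Q t))) := by
    ext x y
    simp only [riccatiSource, sub_apply, add_apply, smul_apply, smul_sub]
    abel
  have h1 : ‖c • (P t - Q t)‖ ≤ c * ‖P t - Q t‖ := by
    refine ContinuousLinearMap.opNorm_le_bound _ (by positivity) fun x => ?_
    rw [smul_apply, norm_smul, Real.norm_eq_abs, abs_of_nonneg hc, mul_assoc]
    exact mul_le_mul_of_nonneg_left ((P t - Q t).le_opNorm x) hc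
  have h2 : (‖P t‖ + ‖Q t‖) * ‖B t‖ * ‖P t - Q t‖ ≤ (R + R) * b * ‖P t - Q t‖ := by
    gcongr
  rw [heq]
  linarith [norm_sub_le (c • (P t - Q t))
    ((P t).comp ((B t).comp (P t)) - (Q t).comp ((B t).comp (Q t))),
    norm_riccati_sub_le (P t) (Q t) (B t)]

variable [CompleteSpace X]

theorem StronglyContinuousOp.riccatiSource (hC : StronglyContinuousOp T C)
    (hB : StronglyContinuousOp T B) (hP : StronglyContinuousOp T P) (c : ℝ) :
    StronglyContinuousOp T (riccatiSource c C B P) :=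
  hC.add ((hP.const_smul c).sub (hP.comp (hB.comp hP)))

/-- Lyapunov solutions depend on the source in a contractive way, in the norm weighted by
`e^{κ(T-t)}` with `κ` large compared to the Lipschitz constant of the source. -/
theorem IsLyapunovSolution.norm_sub_le_half (hU : IsBoundedEvolution T U M) (hc : 0 ≤ c)
    {H K P' Q' : ℝ → X →L[𝕜] AntiDual 𝕜 X} (hH : StronglyContinuousOp T H)
    (hK : StronglyContinuousOp T K) (hP' : IsLyapunovSolution T U c G H P')
    (hQ' : IsLyapunovSolution T U c G K Q') {L a : ℝ} (hL : 0 ≤ L) (ha : 0 ≤ a)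
    (hHK : ∀ t ∈ Icc 0 T, ‖H t - K t‖ ≤ L * ‖P t - Q t‖)
    (hPQ : ∀ t ∈ Icc 0 T, ‖P t - Q t‖ ≤ a * Real.exp ((2 * M ^ 2 * L + 1) * (T - t))) {t : ℝ}
    (ht : t ∈ Icc 0 T) :
    ‖P' t - Q' t‖ ≤ a / 2 * Real.exp ((2 * M ^ 2 * L + 1) * (T - t)) := by
  have hκ : 0 < 2 * M ^ 2 * L + 1 := by positivity
  have hsub := IsLyapunovSolution.sub hU hH hK hP' hQ'
  have h0 : G - G = 0 := sub_self G
  rw [h0] at hsub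
  refine (hsub.norm_le hU hc hκ (a := L * a) (by positivity) (fun r hr => ?_) ht).trans ?_
  · rw [mul_assoc]
    exact (hHK r hr).trans (mul_le_mul_of_nonneg_left (hPQ r hr) hL)
  · refine mul_le_mul_of_nonneg_right ?_ (Real.exp_nonneg _)
    rw [div_le_iff₀ hκ]
    nlinarith

/-- Uniqueness for a source that is Lipschitz in the solution: the weighted distance is at most half
of itself. -/
theorem IsLyapunovSolution.eqOn (hU : IsBoundedEvolution T U M) (hc : 0 ≤ c)
    {H K : ℝ → X →L[𝕜] AntiDual 𝕜 X} (hH : StronglyContinuousOp T H)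
    (hK : StronglyContinuousOp T K) (hPc : StronglyContinuousOp T P)
    (hQc : StronglyContinuousOp T Q) (hP : IsLyapunovSolution T U c G H P)
    (hQ : IsLyapunovSolution T U c G K Q) {L : ℝ} (hL : 0 ≤ L)
    (hHK : ∀ t ∈ Icc 0 T, ‖H t - K t‖ ≤ L * ‖P t - Q t‖) : EqOn P Q (Icc 0 T) := by
  obtain ⟨a, ha, hPQ⟩ := (hPc.sub hQc).exists_bound
  have key : ∀ n : ℕ, ∀ t ∈ Icc 0 T,
      ‖P t - Q t‖ ≤ a / 2 ^ n * Real.exp ((2 * M ^ 2 * L + 1) * (T - t)) := by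
    intro n
    induction n with
    | zero =>
      intro t ht
      rw [pow_zero, div_one]
      refine (hPQ t ht).trans (le_mul_of_one_le_right ha (Real.one_le_exp ?_))
      have := sub_nonneg.2 ht.2
      positivity
    | succ n ih =>
      intro t ht
      rw [pow_succ, ← div_div]
      exact hP.norm_sub_le_half hU hc hH hK hQ hL (by positivity) hHK ih ht
  intro t ht
  have hlim : Filter.Tendsto
      (fun n : ℕ => a / 2 ^ n * Real.exp ((2 * M ^ 2 * L + 1) * (T - t))) Filter.atTop (nhds 0) := by
    have := (tendsto_pow_atTop_nhds_zero_of_lt_one (r := (1 / 2 : ℝ)) (by norm_num)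
      (by norm_num)).const_mul (a * Real.exp ((2 * M ^ 2 * L + 1) * (T - t)))
    rw [mul_zero] at this
    refine this.congr fun n => ?_
    rw [one_div, inv_pow]
    ring
  have h0 : ‖P t - Q t‖ ≤ 0 := ge_of_tendsto' hlim fun n => key n t ht
  exact sub_eq_zero.1 (norm_le_zero_iff.1 h0)

/-- The order interval `0 ≤ P ≤ W` in the space of strongly continuous operator functions. -/
structure IsBetweenZeroAnd (T : ℝ) (W P : ℝ → X →L[𝕜] AntiDual 𝕜 X) : Prop where
  cont : StronglyContinuousOp T P
  nonneg : ∀ t ∈ Icc 0 T, IsNonnegToDual (P t)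
  le : ∀ t ∈ Icc 0 T, IsNonnegToDual (W t - P t)

/-- For `c ≥ ‖B‖ ‖W‖` the discounted Picard map preserves the order interval between zero and the
solution `W` of the Lyapunov equation: its source lies between `0` and `C + c W`, and `W` itself is
the solution with the latter source. -/
theorem IsBetweenZeroAnd.exists_next (hU : IsBoundedEvolution T U M) (hT : 0 ≤ T)
    (hCc : StronglyContinuousOp T C) (hC : ∀ t ∈ Icc 0 T, IsNonnegToDual (C t))
    (hBc : StronglyContinuousOp T B) (hB : ∀ t ∈ Icc 0 T, IsNonnegFromDual (B t))
    (hG : IsNonnegToDual G) {W : ℝ → X →L[𝕜] AntiDual 𝕜 X} (hWc : StronglyContinuousOp T W)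
    (hW : IsLyapunovSolution T U 0 G C W) (hc : 0 ≤ c)
    (hcW : ∀ t ∈ Icc 0 T, ‖B t‖ * ‖W t‖ ≤ c) (hP : IsBetweenZeroAnd T W P) :
    ∃ P', IsBetweenZeroAnd T W P' ∧ IsLyapunovSolution T U c G (riccatiSource c C B P) P' := by
  have hsrc := hCc.riccatiSource hBc hP.cont c
  obtain ⟨P', hP'c, hP'⟩ := hU.exists_isLyapunovSolution hT hsrc hc G
  have hWsrc : StronglyContinuousOp T fun t => C t + (c - 0) • W t :=
    hCc.add (hWc.const_smul _)
  refine ⟨P', ⟨hP'c, fun t ht => ?_, fun t ht => ?_⟩, hP'⟩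
  · refine hP'.isNonnegToDual hU hsrc hG (fun r hr => ?_) ht
    refine (hC r hr).add ((hP.nonneg r hr).smul_sub_riccati (hB r hr) (le_trans ?_ (hcW r hr)))
    exact mul_le_mul_of_nonneg_left ((hP.nonneg r hr).norm_le_of_sub (hP.le r hr))
      (norm_nonneg (B r))
  · have hsub := IsLyapunovSolution.sub hU hWsrc hsrc (hW.rediscount hU hCc c) hP'
    have h0 : G - G = 0 := sub_self G
    refine hsub.isNonnegToDual hU (hWsrc.sub hsrc) (h0 ▸ .zero) (fun r hr => ?_) ht
    have heq : C r + (c - 0) • W r - riccatiSource c C B P r =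
        c • (W r - P r) + (P r).comp ((B r).comp (P r)) := by
      ext x y
      simp only [riccatiSource, sub_apply, add_apply, smul_apply, smul_sub, sub_zero]
      abel
    rw [heq]
    exact ((hP.le r hr).smul hc).add ((hP.nonneg r hr).riccati (hB r hr))

/-- The solution is the limit of the discounted Picard iteration that starts at the upper end `W` of
the order interval. -/
theorem exists_isRiccatiSolution (hU : IsBoundedEvolution T U M) (hT : 0 ≤ T)
    (hCc : StronglyContinuousOp T C) (hC : ∀ t ∈ Icc 0 T, IsNonnegToDual (C t))
    (hBc : StronglyContinuousOp T B) (hB : ∀ t ∈ Icc 0 T, IsNonnegFromDual (B t))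
    (hG : IsNonnegToDual G) :
    ∃ P, IsRiccatiSolution T U (adjointFamily U) C B G P ∧
      ∀ t ∈ Icc 0 T, IsNonnegToDual (P t) := by
  obtain ⟨W, hWc, hW⟩ := hU.exists_isLyapunovSolution hT hCc le_rfl G
  obtain ⟨R, hR, hWR⟩ := hWc.exists_bound
  obtain ⟨b, hb, hBb⟩ := hBc.exists_bound
  set c : ℝ := b * R
  have hc : 0 ≤ c := by positivity
  have hcW : ∀ t ∈ Icc 0 T, ‖B t‖ * ‖W t‖ ≤ c := fun t ht =>
    mul_le_mul (hBb t ht) (hWR t ht) (norm_nonneg _) hb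
  have hbd : ∀ {P}, IsBetweenZeroAnd T W P → ∀ t ∈ Icc 0 T, ‖P t‖ ≤ R := fun hP t ht =>
    ((hP.nonneg t ht).norm_le_of_sub (hP.le t ht)).trans (hWR t ht)
  -- The discounted Picard map; only its values on the order interval matter.
  choose! Φ hΦ hΦsol using fun P (hP : IsBetweenZeroAnd T W P) =>
    hP.exists_next hU hT hCc hC hBc hB hG hWc hW hc hcW
  set L : ℝ := c + 2 * R * b
  have hL : 0 ≤ L := by positivity
  set κ : ℝ := 2 * M ^ 2 * L + 1
  have hκ : 0 ≤ κ := by positivity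
  have hcontr : ∀ {P Q : ℝ → X →L[𝕜] AntiDual 𝕜 X} {a : ℝ}, IsBetweenZeroAnd T W P →
      IsBetweenZeroAnd T W Q → 0 ≤ a →
      (∀ t ∈ Icc 0 T, ‖P t - Q t‖ ≤ a * Real.exp (κ * (T - t))) →
      ∀ t ∈ Icc 0 T, ‖Φ P t - Φ Q t‖ ≤ a / 2 * Real.exp (κ * (T - t)) :=
    fun {P Q a} hP hQ ha hPQ t ht =>
      (hΦsol P hP).norm_sub_le_half hU hc (hCc.riccatiSource hBc hP.cont c)
        (hCc.riccatiSource hBc hQ.cont c) (hΦsol Q hQ) hL ha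
        (fun r hr => norm_riccatiSource_sub_le hR hc (hBb r hr) (hbd hP r hr) (hbd hQ r hr))
        hPQ ht
  have hW0 : IsBetweenZeroAnd T W W :=
    ⟨hWc, fun t ht => hW.isNonnegToDual hU hCc hG hC ht, fun t _ => by
      have h0 : W t - W t = 0 := sub_self (W t)
      rw [h0]; exact .zero⟩
  set p : ℕ → ℝ → X →L[𝕜] AntiDual 𝕜 X := fun n => Φ^[n] W
  have hpS : ∀ n, p (n + 1) = Φ (p n) := fun n => Function.iterate_succ_apply' Φ n W
  have hpb : ∀ n, IsBetweenZeroAnd T W (p n) := by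
    intro n
    induction n with
    | zero => exact hW0
    | succ n ih => rw [hpS]; exact hΦ _ ih
  have hstep : ∀ n : ℕ, ∀ t ∈ Icc 0 T,
      ‖p n t - p (n + 1) t‖ ≤ 2 * R / 2 ^ n * Real.exp (κ * (T - t)) := by
    intro n
    induction n with
    | zero =>
      intro t ht
      have h1 : ‖p 0 t - p 1 t‖ ≤ 2 * R :=
        (norm_sub_le (p 0 t) (p 1 t)).trans (by linarith [hbd (hpb 0) t ht, hbd (hpb 1) t ht])
      rw [pow_zero, div_one]
      refine h1.trans (le_mul_of_one_le_right (by positivity) (Real.one_le_exp ?_))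
      have := sub_nonneg.2 ht.2
      positivity
    | succ n ih =>
      intro t ht
      rw [pow_succ, ← div_div, hpS n, hpS (n + 1), hpS n]
      rw [hpS n] at ih
      exact hcontr (hpb n) (hΦ _ (hpb n)) (by positivity) ih t ht
  have hgeo : ∀ t ∈ Icc 0 T, ∀ n : ℕ,
      dist (p n t) (p (n + 1) t) ≤ 4 * R * Real.exp (κ * (T - t)) / 2 / 2 ^ n := by
    intro t ht n
    refine (dist_eq_norm (p n t) (p (n + 1) t)).le.trans ((hstep n t ht).trans_eq ?_)
    ring
  have hlim : ∀ t, ∃ S : X →L[𝕜] AntiDual 𝕜 X, t ∈ Icc 0 T →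
      Filter.Tendsto (fun n => p n t) Filter.atTop (nhds S) := by
    intro t
    by_cases ht : t ∈ Icc 0 T
    · obtain ⟨S, hS⟩ := cauchySeq_tendsto_of_complete (cauchySeq_of_le_geometric_two (hgeo t ht))
      exact ⟨S, fun _ => hS⟩
    · exact ⟨0, fun h => absurd h ht⟩
  choose P hP using hlim
  have hdist : ∀ n : ℕ, ∀ t ∈ Icc 0 T,
      ‖p n t - P t‖ ≤ 4 * R / 2 ^ n * Real.exp (κ * (T - t)) := by
    intro n t ht
    refine (dist_eq_norm (p n t) (P t)).ge.trans
      ((dist_le_of_le_geometric_two_of_tendsto (hgeo t ht) (hP t ht) n).trans_eq ?_)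
    ring
  have hzero : ∀ K : ℝ, Filter.Tendsto (fun n : ℕ => 4 * R / 2 ^ n * K)
      Filter.atTop (nhds 0) := by
    intro K
    have := (tendsto_pow_atTop_nhds_zero_of_lt_one (r := (1 / 2 : ℝ)) (by norm_num)
      (by norm_num)).const_mul (4 * R * K)
    rw [mul_zero] at this
    refine this.congr fun n => ?_
    rw [one_div, inv_pow]
    ring
  have hPc : StronglyContinuousOp T P := by
    intro x
    have hunif : TendstoUniformlyOn (fun n t => p n t x) (fun t => P t x) Filter.atTop
        (Icc 0 T) := by
      rw [Metric.tendstoUniformlyOn_iff]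
      intro ε hε
      filter_upwards [(hzero (Real.exp (κ * T) * ‖x‖)).eventually (gt_mem_nhds hε)] with n hn t ht
      rw [dist_comm, dist_eq_norm]
      refine lt_of_le_of_lt ?_ hn
      rw [← mul_assoc]
      refine (p n t - P t).le_of_opNorm_le ((hdist n t ht).trans ?_) x
      have : T - t ≤ T := by linarith [ht.1]
      gcongr
    exact hunif.continuousOn (Filter.Eventually.of_forall fun n => (hpb n).cont x).frequently
  have hPb : IsBetweenZeroAnd T W P :=
    ⟨hPc, fun t ht => .of_tendsto (fun n => (hpb n).nonneg t ht) (hP t ht),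
      fun t ht => .of_tendsto (fun n => (hpb n).le t ht) ((hP t ht).const_sub (W t))⟩
  have hfix : ∀ t ∈ Icc 0 T, Φ P t = P t := by
    intro t ht
    refine tendsto_nhds_unique (tendsto_iff_norm_sub_tendsto_zero.2 ?_)
      ((hP t ht).comp (Filter.tendsto_add_atTop_nat 1))
    refine squeeze_zero (fun n => norm_nonneg (p (n + 1) t - Φ P t)) (fun n => ?_)
      (hzero (1 / 2 * Real.exp (κ * (T - t))))
    rw [Function.comp_apply, hpS]
    refine (hcontr (hpb n) hPb (by positivity) (hdist n) t ht).trans_eq ?_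
    ring
  have hPsol : IsLyapunovSolution T U c G (riccatiSource c C B P) P := fun t ht x => by
    rw [← hΦsol P hPb t ht x, hfix t ht]
  refine ⟨P, isRiccatiSolution_iff.2 ⟨hPc, ?_⟩, hPb.nonneg⟩
  have hred := hPsol.rediscount hU (hCc.riccatiSource hBc hPc c) 0
  have heq : (fun t => riccatiSource c C B P t + (0 - c) • P t) =
      fun t => C t - (P t).comp ((B t).comp (P t)) := by
    funext t
    ext x y
    simp only [riccatiSource, sub_apply, add_apply, smul_apply, zero_sub, neg_smul]
    abel
  rwa [heq] at hred

theorem IsRiccatiSolution.eqOn (hU : IsBoundedEvolution T U M)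
    (hCc : StronglyContinuousOp T C) (hBc : StronglyContinuousOp T B)
    (hP : IsRiccatiSolution T U (adjointFamily U) C B G P)
    (hQ : IsRiccatiSolution T U (adjointFamily U) C B G Q) : EqOn P Q (Icc 0 T) := by
  obtain ⟨hPc, hP⟩ := isRiccatiSolution_iff.1 hP
  obtain ⟨hQc, hQ⟩ := isRiccatiSolution_iff.1 hQ
  obtain ⟨R, hR, hPR⟩ := hPc.exists_bound
  obtain ⟨S, hS, hQS⟩ := hQc.exists_bound
  obtain ⟨b, hb, hBb⟩ := hBc.exists_bound
  refine hP.eqOn hU le_rfl (hCc.sub (hPc.comp (hBc.comp hPc))) (hCc.sub (hQc.comp (hBc.comp hQc)))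
    hPc hQc hQ (L := (R + S) * b) (by positivity) fun t ht => ?_
  have heq : C t - (P t).comp ((B t).comp (P t)) - (C t - (Q t).comp ((B t).comp (Q t))) =
      (Q t).comp ((B t).comp (Q t)) - (P t).comp ((B t).comp (P t)) := by
      ext x y
      simp only [sub_apply]
      abel
  rw [heq]
  refine (norm_sub_rev ((Q t).comp ((B t).comp (Q t))) ((P t).comp ((B t).comp (P t)))).le.trans
    ((norm_riccati_sub_le (P t) (Q t) (B t)).trans ?_)
  have h1 := hPR t ht
  have h2 := hQS t ht
  have h3 := hBb t ht
  gcongr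

end Riccati

theorem theorem3p1 {𝕜 : Type*} [RCLike 𝕜] {X : Type*} [NormedAddCommGroup X] [NormedSpace 𝕜 X]
    [CompleteSpace X] (hX : IsReflexiveSpace 𝕜 X) (T : ℝ) (hT : 0 ≤ T)
    (U : ℝ → ℝ → X →L[𝕜] X)
    (hU : IsForwardEvolutionFamily T U)
    (hU_cont : IsStronglyContinuousForward T U)
    (hU_bdd : IsUniformlyBoundedForward T U)
    (hV_cont : IsStronglyContinuousBackward T (adjointFamily U))
    (C : ℝ → X →L[𝕜] AntiDual 𝕜 X) (hC_cont : StronglyContinuousOp T C)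
    (hC : ∀ t ∈ Set.Icc 0 T, IsNonnegToDual (C t))
    (B : ℝ → AntiDual 𝕜 X →L[𝕜] X) (hB_cont : StronglyContinuousOp T B)
    (hB : ∀ t ∈ Set.Icc 0 T, IsNonnegFromDual (B t))
    (G : X →L[𝕜] AntiDual 𝕜 X) (hG : IsNonnegToDual G) :
    ∃ P : ℝ → X →L[𝕜] AntiDual 𝕜 X,
      IsRiccatiSolution T U (adjointFamily U) C B G P ∧
      (∀ Q : ℝ → X →L[𝕜] AntiDual 𝕜 X,
        IsRiccatiSolution T U (adjointFamily U) C B G Q → Set.EqOn Q P (Set.Icc 0 T)) ∧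
      ∀ t ∈ Set.Icc 0 T, IsNonnegToDual (P t) := by
  obtain ⟨M, hM⟩ := hU_bdd
  have hUM : IsBoundedEvolution T U M := ⟨hU, hU_cont, hV_cont, hM⟩
  obtain ⟨P, hP, hPnn⟩ := exists_isRiccatiSolution hUM hT hC_cont hC hB_cont hB hG
  exact ⟨P, hP, fun Q hQ => hQ.eqOn hUM hC_cont hB_cont hP, hPnn⟩
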